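/- Let $n\ge 0$ be an integer, let $d_0>0$, and let $H$ be a real-valued function that is $C^\infty$ on $[0,d_0)$ (with one-sided derivatives at $0$) and satisfies $H(0)>0$. Consider the singular initial value problem \[ (1-2ns)\,\gamma'(s)-H(\gamma(s))+4\,\frac{s\gamma'(s)+s^2\gamma''(s)}{1+4s^2\gamma'(s)^2}=0\quad (s>0),\qquad \gamma(0)=0. \tag{$*$} \] (i) There is exactly one real sequence $(A_k)_{k\ge 0}$ with $A_0=0$ such that the formal power series $\Gamma(s)=\sum_{k\ge1}\frac{A_k}{k!}s^k$ satisfies $(*)$ formally, that is, as an identity in $\mathbb R[[s]]$ in which $H$ is replaced by its Taylor series $\sum_{k\ge0}\frac{H^{(k)}(0)}{k!}x^k$ at $0$, $H(\gamma)$ by the substitution of $\Gamma$ for $x$ in that series, and division by $1+4s^2\Gamma'^2$ is the inverse in $\mathbb R[[s]]$. (ii) There is $s_0>0$, depending only on $n$ and on $H$ (with its domain $[0,d_0)$), such that $(*)$ has a solution $\gamma\in C^\infty[0,s_0]$ with values in $[0,d_0)$ satisfying the equation for $0<s\le s_0$, and every solution in $C^\infty[0,s_0]$ with values in $[0,d_0)$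 coincides with $\gamma$ on $[0,s_0]$. Moreover $\gamma>0$ on $(0,s_0]$, $\gamma'>0$ on $[0,s_0]$, and $\gamma^{(k)}(0)=A_k$ for all $k\ge 0$ (one-sided derivatives at the endpoints). -/

import Mathlib

open scoped ContDiff

/-- `γ` is a solution, smooth up to both endpoints of `[0, s₀]`, of the singular initial value
problem
`(1 - 2 n s) γ' - H(γ) + 4 (s γ' + s² γ'') / (1 + 4 s² γ'²) = 0` for `0 < s ≤ s₀`, `γ(0) = 0`,
where `H` is a function on `[0, d₀)` and hence `γ` takes its values there.
Derivatives are one-sided at the endpoints; only the values of `γ` on `[0, s₀]` matter. -/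
structure IsSmoothSolution (n : ℕ) (H : ℝ → ℝ) (d₀ s₀ : ℝ) (γ : ℝ → ℝ) : Prop where
  smooth : ContDiffOn ℝ ∞ γ (Set.Icc 0 s₀)
  mapsTo : Set.MapsTo γ (Set.Icc 0 s₀) (Set.Ico 0 d₀)
  initial : γ 0 = 0
  equation : ∀ s ∈ Set.Ioc 0 s₀,
    (1 - 2 * (n : ℝ) * s) * derivWithin γ (Set.Icc 0 s₀) s - H (γ s)
      + 4 * ((s * derivWithin γ (Set.Icc 0 s₀) s
              + s ^ 2 * iteratedDerivWithin 2 γ (Set.Icc 0 s₀) s)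
          / (1 + 4 * s ^ 2 * (derivWithin γ (Set.Icc 0 s₀) s) ^ 2)) = 0

/-- The formal power series `∑ (A k / k!) Xᵏ`. -/
noncomputable def expSeries (A : ℕ → ℝ) : PowerSeries ℝ :=
  PowerSeries.mk fun k => A k / (k.factorial : ℝ)

/-- The Taylor series `∑ (H⁽ᵏ⁾(0) / k!) Xᵏ` at `0` of a function `H` on `[0, d₀)`. -/
noncomputable def taylorSeriesAtZero (H : ℝ → ℝ) (d₀ : ℝ) : PowerSeries ℝ :=
  expSeries fun k => iteratedDerivWithin k H (Set.Ico 0 d₀) 0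

/-- `Γ = ∑_{k ≥ 1} (A k / k!) Xᵏ` solves the initial value problem as a formal power series:
`H` is replaced by its Taylor series at `0`, the composition `H(γ)` by the substitution of `Γ`
into it (meaningful as `Γ` has no constant term), and the quotient is multiplication
by the inverse of a formal power series with constant term `1`. -/
structure IsFormalSolution (n : ℕ) (H : ℝ → ℝ) (d₀ : ℝ) (A : ℕ → ℝ) : Prop where
  initial : A 0 = 0
  equation :
    (1 - 2 * (n : PowerSeries ℝ) * PowerSeries.X) * PowerSeries.derivative ℝ (expSeries A)
      - PowerSeries.subst (expSeries A) (taylorSeriesAtZero H d₀)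
      + 4 * ((PowerSeries.X * PowerSeries.derivative ℝ (expSeries A)
              + PowerSeries.X ^ 2 *
                  PowerSeries.derivative ℝ (PowerSeries.derivative ℝ (expSeries A)))
          * (1 + 4 * PowerSeries.X ^ 2 * (PowerSeries.derivative ℝ (expSeries A)) ^ 2)⁻¹) = 0

/-! Put `p = γ'`. Clearing the denominator turns the equation into `4 s² p' + p = H(γ) + s G(s,
H(γ), p)` with `G` polynomial. At the irregular singular point `0` the homogeneous equation `4 s² u'
+ u = 0` has only multiples of `exp(1/(4s))` as solutions, unbounded as `s → 0+`. So `4 s² u' + u =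
f` has exactly one bounded solution, and this is a weighted mean of `f` over `[0, s]`
(`singularMean`), with weights the derivative of `exp(-1/(4t))`. Taking means does not increase sup
norms. On the right-hand side `γ = ∫ p` and the factor `s` both make the dependence on `p` small on
a short interval, so a contraction argument gives a solution with `p` close to `H(0) > 0`
(`exists_solution_near_zero`); positivity of `γ` and `γ'` comes with it.

Smoothness at `0` is bootstrapped: a continuous solution of `4 s² u' + (1 + a s) u = f` is as smooth
as `f` (`contDiffOn_of_singular_ode`), because `u'` solves an equation of the same type with `a + 8`
in place of `a`.

Uniqueness comes from the energy `(β - γ)² + 2 s² (β' - γ')²`, whose derivative contains the damping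
term `-(β' - γ')²` (`eqOn_of_singular_ivp`).

The formal equation determines each coefficient of `Γ'` from the earlier ones, hence has at most one
solution (`ClearedFormalEquation.unique`). No recursion is needed for formal existence: the Taylor
series of the smooth solution solves it (`cleared_taylorSeriesWithin`), which also identifies the
derivatives at `0` with the `A k`. -/

open Set Filter Topology

/-! ### Formal power series: uniqueness of the formal solution -/

section Formal

open PowerSeries

lemma PowerSeries.X_pow_dvd_derivative {k : ℕ} {φ : PowerSeries ℝ}
    (h : (X : PowerSeries ℝ) ^ (k + 1) ∣ φ) : (X : PowerSeries ℝ) ^ k ∣ derivative ℝ φ := by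
  rw [X_pow_dvd_iff] at h ⊢
  intro m hm
  rw [coeff_derivative, h (m + 1) (by omega), zero_mul]

lemma PowerSeries.X_pow_dvd_X_sq_mul_derivative_derivative {k : ℕ} {φ : PowerSeries ℝ}
    (h : (X : PowerSeries ℝ) ^ (k + 1) ∣ φ) :
    (X : PowerSeries ℝ) ^ (k + 1) ∣ X ^ 2 * derivative ℝ (derivative ℝ φ) := by
  have h1 := X_pow_dvd_derivative h
  rcases k with _ | j
  · exact Dvd.dvd.mul_right (pow_dvd_pow _ (by norm_num)) _
  · rw [show j + 1 + 1 = 2 + j by omega, pow_add]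
    exact mul_dvd_mul_left _ (X_pow_dvd_derivative h1)

lemma PowerSeries.X_pow_dvd_of_X_pow_dvd_derivative {k : ℕ} {φ : PowerSeries ℝ}
    (h0 : constantCoeff φ = 0) (h : (X : PowerSeries ℝ) ^ k ∣ derivative ℝ φ) :
    (X : PowerSeries ℝ) ^ (k + 1) ∣ φ := by
  rw [X_pow_dvd_iff] at h ⊢
  intro m hm
  rcases m with _ | m
  · simpa using h0
  · have := h m (by omega)
    rw [coeff_derivative] at this
    exact (mul_eq_zero.1 this).resolve_right (by positivity)

/-- Substitution of power series without constant term is continuous in the `X`-adic topology. -/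
lemma PowerSeries.X_pow_dvd_subst_sub_subst {m : ℕ} {Γ Δ : PowerSeries ℝ} (φ : PowerSeries ℝ)
    (hΓ : constantCoeff Γ = 0) (hΔ : constantCoeff Δ = 0)
    (h : (X : PowerSeries ℝ) ^ m ∣ Γ - Δ) :
    (X : PowerSeries ℝ) ^ m ∣ subst Γ φ - subst Δ φ := by
  -- Modulo `X ^ m` only the truncation of `φ` matters, since the remainder `X ^ m * ψ` becomes a
  -- multiple of `Λ ^ m` and `X ∣ Λ`. For a polynomial, `Γ - Δ` divides the difference of its
  -- values.
  obtain ⟨ψ, hψ⟩ : (X : PowerSeries ℝ) ^ m ∣ φ - (trunc m φ : PowerSeries ℝ) := by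
    rw [X_pow_dvd_iff]
    intro j hj
    simp [coeff_trunc, hj]
  have hφ : φ = (trunc m φ : PowerSeries ℝ) + X ^ m * ψ := by rw [← hψ]; ring
  have key : ∀ Λ : PowerSeries ℝ, constantCoeff Λ = 0 →
      (X : PowerSeries ℝ) ^ m ∣ subst Λ φ - Polynomial.aeval Λ (trunc m φ) := by
    intro Λ hΛ
    have hs : HasSubst Λ := HasSubst.of_constantCoeff_zero' hΛ
    conv_rhs => rw [hφ]
    have hX : (X : PowerSeries ℝ) ∣ Λ := X_dvd_iff.2 hΛ
    rw [subst_add hs, subst_mul hs, subst_pow hs, subst_X hs, subst_coe hs, ← hφ]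
    rw [add_sub_cancel_left]
    exact Dvd.dvd.mul_right (pow_dvd_pow_of_dvd hX m) _
  have hpoly : (X : PowerSeries ℝ) ^ m ∣
      Polynomial.aeval Γ (trunc m φ) - Polynomial.aeval Δ (trunc m φ) := by
    refine h.trans ?_
    rw [Polynomial.aeval_def, Polynomial.aeval_def, Polynomial.eval₂_eq_eval_map,
      Polynomial.eval₂_eq_eval_map]
    exact Polynomial.sub_dvd_eval_sub _ _ _
  have := dvd_add (dvd_sub (key Γ hΓ) (key Δ hΔ)) hpoly
  convert this using 1
  ring

/-- The formal equation with the denominator cleared. -/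
def ClearedFormalEquation (n : ℕ) (φ Γ : PowerSeries ℝ) : Prop :=
  (1 + 4 * X ^ 2 * (derivative ℝ Γ) ^ 2) *
      ((1 - 2 * (n : PowerSeries ℝ) * X) * derivative ℝ Γ - subst Γ φ)
    + 4 * (X * derivative ℝ Γ + X ^ 2 * derivative ℝ (derivative ℝ Γ)) = 0

lemma formalEquation_iff_cleared (n : ℕ) (φ Γ : PowerSeries ℝ) :
    (1 - 2 * (n : PowerSeries ℝ) * X) * derivative ℝ Γ - subst Γ φ
      + 4 * ((X * derivative ℝ Γ + X ^ 2 * derivative ℝ (derivative ℝ Γ))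
          * (1 + 4 * X ^ 2 * (derivative ℝ Γ) ^ 2)⁻¹) = 0 ↔ ClearedFormalEquation n φ Γ := by
  have hne : constantCoeff (1 + 4 * X ^ 2 * (derivative ℝ Γ) ^ 2 : PowerSeries ℝ) ≠ 0 := by
    simp
  have hinv := PowerSeries.mul_inv_cancel _ hne
  unfold ClearedFormalEquation
  constructor
  · intro h
    linear_combination (1 + 4 * X ^ 2 * (derivative ℝ Γ) ^ 2) * h
      - 4 * (X * derivative ℝ Γ + X ^ 2 * derivative ℝ (derivative ℝ Γ)) * hinv
  · intro h
    linear_combination (1 + 4 * X ^ 2 * (derivative ℝ Γ) ^ 2)⁻¹ * h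
      - ((1 - 2 * (n : PowerSeries ℝ) * X) * derivative ℝ Γ - subst Γ φ) * hinv

/-- Every occurrence of a derivative except the leading `Γ'` carries enough powers of `X` to undo
the loss of order. So agreement of `Γ` and `Δ` modulo `X ^ (k + 1)` forces agreement of `Γ'` and
`Δ'` modulo `X ^ (k + 1)`, which gains one order for `Γ` and `Δ`. -/
lemma ClearedFormalEquation.unique {n : ℕ} {φ Γ Δ : PowerSeries ℝ}
    (hΓ0 : constantCoeff Γ = 0) (hΔ0 : constantCoeff Δ = 0)
    (hΓ : ClearedFormalEquation n φ Γ) (hΔ : ClearedFormalEquation n φ Δ) : Γ = Δ := by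
  have hdvd : ∀ k : ℕ, (X : PowerSeries ℝ) ^ (k + 1) ∣ Γ - Δ := by
    intro k
    induction k with
    | zero => rw [zero_add, pow_one, X_dvd_iff]; simp [hΓ0, hΔ0]
    | succ k ih =>
      refine X_pow_dvd_of_X_pow_dvd_derivative (by simp [hΓ0, hΔ0]) ?_
      obtain ⟨c₁, h₁⟩ := X_pow_dvd_derivative ih
      obtain ⟨c₂, h₂⟩ := X_pow_dvd_subst_sub_subst φ hΓ0 hΔ0 ih
      obtain ⟨c₃, h₃⟩ := X_pow_dvd_X_sq_mul_derivative_derivative ih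
      unfold ClearedFormalEquation at hΓ hΔ
      simp only [map_sub] at h₁ h₃ ⊢
      set u := derivative ℝ Γ
      set v := derivative ℝ Δ
      set U := derivative ℝ u
      set V := derivative ℝ v
      set P := subst Γ φ
      set Q := subst Δ φ
      -- The quotient is obtained by subtracting the two equations, solving for `u - v`, and
      -- factoring `X² (u² - v²)` as `X (u + v) * X (u - v)`.
      refine ⟨(2 * (n : PowerSeries ℝ) - 4) * c₁ - 4 * c₃ + c₂
        - 4 * X * (u + v) * ((1 - 2 * (n : PowerSeries ℝ) * X) * u - P) * c₁
        - 4 * X * v ^ 2 * (1 - 2 * (n : PowerSeries ℝ) * X) * c₁ + 4 * X ^ 2 * v ^ 2 * c₂, ?_⟩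
      have h₁' : X * (u - v) = X ^ (k + 1) * c₁ := by rw [h₁]; ring
      linear_combination hΓ - hΔ + ((2 * (n : PowerSeries ℝ) - 4)
        - 4 * X * (u + v) * ((1 - 2 * (n : PowerSeries ℝ) * X) * u - P)
        - 4 * X * v ^ 2 * (1 - 2 * (n : PowerSeries ℝ) * X)) * h₁' - 4 * h₃
        + (1 + 4 * X ^ 2 * v ^ 2) * h₂
  ext m
  have := (X_pow_dvd_iff.1 (hdvd m)) m (by omega)
  simpa [sub_eq_zero] using this

end Formal

/-! ### Taylor series at `0` as a map compatible with sums, products and composition -/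

section Taylor

open PowerSeries

/-- The Taylor series at `0` of a function on a set of reals. -/
noncomputable def taylorSeriesWithin (f : ℝ → ℝ) (S : Set ℝ) : PowerSeries ℝ :=
  expSeries fun k => iteratedDerivWithin k f S 0

lemma constantCoeff_taylorSeriesWithin (f : ℝ → ℝ) (S : Set ℝ) :
    constantCoeff (taylorSeriesWithin f S) = f 0 := by
  simp [taylorSeriesWithin, expSeries, ← coeff_zero_eq_constantCoeff_apply]

lemma coeff_zero_taylorSeriesWithin (f : ℝ → ℝ) (S : Set ℝ) :
    coeff 0 (taylorSeriesWithin f S) = f 0 := by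
  simp [taylorSeriesWithin, expSeries]

lemma derivative_taylorSeriesWithin (f : ℝ → ℝ) (S : Set ℝ) :
    derivative ℝ (taylorSeriesWithin f S) = taylorSeriesWithin (derivWithin f S) S := by
  ext k
  simp only [taylorSeriesWithin, expSeries, coeff_derivative, coeff_mk, ← iteratedDerivWithin_succ',
    Nat.factorial_succ]
  push_cast
  field_simp

lemma taylorSeriesWithin_congr {f g : ℝ → ℝ} {S : Set ℝ} (h0 : (0 : ℝ) ∈ S) (h : EqOn f g S) :
    taylorSeriesWithin f S = taylorSeriesWithin g S := by
  ext k
  simp only [taylorSeriesWithin, expSeries, coeff_mk]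
  rw [iteratedDerivWithin_congr h h0]

lemma coeff_succ_of_derivative (φ : PowerSeries ℝ) (k : ℕ) :
    coeff (k + 1) φ = coeff k (derivative ℝ φ) / (k + 1) := by
  rw [coeff_derivative]; field_simp

lemma ContDiffOn.derivWithin_infty {f : ℝ → ℝ} {S : Set ℝ} (hS : UniqueDiffOn ℝ S)
    (hf : ContDiffOn ℝ ∞ f S) : ContDiffOn ℝ ∞ (derivWithin f S) S :=
  ((contDiffOn_infty_iff_derivWithin hS).1 hf).2

lemma taylorSeriesWithin_add {f g : ℝ → ℝ} {S : Set ℝ} (hS : UniqueDiffOn ℝ S) (h0 : (0 : ℝ) ∈ S)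
    (hf : ContDiffOn ℝ ∞ f S) (hg : ContDiffOn ℝ ∞ g S) :
    taylorSeriesWithin (fun x => f x + g x) S
      = taylorSeriesWithin f S + taylorSeriesWithin g S := by
  ext k
  have hk : ((k : ℕ∞) : WithTop ℕ∞) ≤ ∞ := by exact_mod_cast le_top
  simp only [taylorSeriesWithin, expSeries, coeff_mk, map_add]
  rw [iteratedDerivWithin_fun_add h0 hS ((hf 0 h0).of_le hk) ((hg 0 h0).of_le hk), add_div]

/-- Both sides obey the Leibniz rule, and coefficient `k + 1` of a series is read off from
coefficient `k` of its derivative; hence the induction over all pairs `f`, `g` at once. -/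
lemma taylorSeriesWithin_mul {f g : ℝ → ℝ} {S : Set ℝ} (hS : UniqueDiffOn ℝ S) (h0 : (0 : ℝ) ∈ S)
    (hf : ContDiffOn ℝ ∞ f S) (hg : ContDiffOn ℝ ∞ g S) :
    taylorSeriesWithin (fun x => f x * g x) S
      = taylorSeriesWithin f S * taylorSeriesWithin g S := by
  ext k
  induction k generalizing f g with
  | zero => simp [coeff_zero_taylorSeriesWithin, constantCoeff_taylorSeriesWithin]
  | succ k ih =>
    rw [coeff_succ_of_derivative, coeff_succ_of_derivative, derivative_taylorSeriesWithin,
      Derivation.leibniz]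
    have hf' := hf.derivWithin_infty hS
    have hg' := hg.derivWithin_infty hS
    have hE : EqOn (derivWithin (fun x => f x * g x) S)
        (fun x => f x * derivWithin g S x + g x * derivWithin f S x) S := by
      intro x hx
      rw [derivWithin_fun_mul (hf.differentiableOn (by simp) x hx)
        (hg.differentiableOn (by simp) x hx)]
      ring
    rw [taylorSeriesWithin_congr h0 hE, taylorSeriesWithin_add hS h0 (hf.mul hg') (hg.mul hf'),
      map_add, map_add, ih hf hg', ih hg hf', derivative_taylorSeriesWithin,
      derivative_taylorSeriesWithin, smul_eq_mul, smul_eq_mul]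

/-- Both sides obey the chain rule. The induction is strong and general in `h` because coefficient
`k` of `(h' ∘ f) * f'` involves all coefficients of `h' ∘ f` up to `k`. -/
lemma taylorSeriesWithin_comp {f h : ℝ → ℝ} {S T : Set ℝ} (hS : UniqueDiffOn ℝ S)
    (h0 : (0 : ℝ) ∈ S) (hT : UniqueDiffOn ℝ T) (hf : ContDiffOn ℝ ∞ f S)
    (hh : ContDiffOn ℝ ∞ h T) (hmaps : MapsTo f S T) (hf0 : f 0 = 0) :
    taylorSeriesWithin (fun x => h (f x)) S
      = subst (taylorSeriesWithin f S) (taylorSeriesWithin h T) := by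
  have hc : constantCoeff (taylorSeriesWithin f S) = 0 := by
    rw [constantCoeff_taylorSeriesWithin, hf0]
  have hs : HasSubst (taylorSeriesWithin f S) := HasSubst.of_constantCoeff_zero' hc
  ext k
  induction k using Nat.strong_induction_on generalizing h with
  | _ k ih =>
  rcases k with _ | k
  · have h1 := X_pow_dvd_subst_sub_subst (m := 1) (Γ := taylorSeriesWithin f S) (Δ := 0)
      (taylorSeriesWithin h T) hc (by simp) (by rw [pow_one, X_dvd_iff]; simp [hc])
    rw [pow_one, X_dvd_iff, map_sub, sub_eq_zero, subst_zero_eq_C_constantCoeff] at h1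
    rw [coeff_zero_taylorSeriesWithin, coeff_zero_eq_constantCoeff_apply, h1,
      constantCoeff_taylorSeriesWithin, hf0]
    exact (constantCoeff_C (R := ℝ) (h 0)).symm
  · have hh' := hh.derivWithin_infty hT
    have hf' := hf.derivWithin_infty hS
    have hE : EqOn (derivWithin (fun x => h (f x)) S)
        (fun x => derivWithin h T (f x) * derivWithin f S x) S := by
      intro x hx
      exact derivWithin_comp x (hh.differentiableOn (by simp) _ (hmaps hx))
        (hf.differentiableOn (by simp) x hx) hmaps
    rw [coeff_succ_of_derivative, coeff_succ_of_derivative, derivative_taylorSeriesWithin,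
      derivative_subst hs, taylorSeriesWithin_congr h0 hE,
      taylorSeriesWithin_mul (f := fun x => derivWithin h T (f x)) hS h0 (hh'.comp hf hmaps) hf',
      derivative_taylorSeriesWithin,
      derivative_taylorSeriesWithin, coeff_mul, coeff_mul]
    congr 1
    refine Finset.sum_congr rfl fun p hp => ?_
    rw [ih p.1 (by have := Finset.HasAntidiagonal.mem_antidiagonal.1 hp; omega) hh']

lemma taylorSeriesWithin_const {S : Set ℝ} (c : ℝ) :
    taylorSeriesWithin (fun _ => c) S = C c := by
  ext k
  rcases k with _ | k
  · simp [coeff_zero_taylorSeriesWithin]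
  · simp [taylorSeriesWithin, expSeries, iteratedDerivWithin_const]

lemma taylorSeriesWithin_id {S : Set ℝ} (hS : UniqueDiffOn ℝ S) (h0 : (0 : ℝ) ∈ S) :
    taylorSeriesWithin (fun x => x) S = X := by
  refine derivative.ext ?_ ?_
  · rw [derivative_taylorSeriesWithin, derivative_X,
      taylorSeriesWithin_congr h0 (g := fun _ => (1 : ℝ)), taylorSeriesWithin_const, map_one]
    intro x hx
    exact derivWithin_id' x S (hS x hx)
  · simp [constantCoeff_taylorSeriesWithin]

/-- The Taylor series of a smooth solution solves the formal equation. -/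
lemma cleared_taylorSeriesWithin {n : ℕ} {H γ : ℝ → ℝ} {S T : Set ℝ} (hS : UniqueDiffOn ℝ S)
    (h0 : (0 : ℝ) ∈ S) (hT : UniqueDiffOn ℝ T) (hγ : ContDiffOn ℝ ∞ γ S)
    (hH : ContDiffOn ℝ ∞ H T) (hmaps : MapsTo γ S T) (hγ0 : γ 0 = 0)
    (heq : ∀ s ∈ S, (1 + 4 * s ^ 2 * derivWithin γ S s ^ 2) *
        ((1 - 2 * (n : ℝ) * s) * derivWithin γ S s - H (γ s))
      + 4 * (s * derivWithin γ S s + s ^ 2 * derivWithin (derivWithin γ S) S s) = 0) :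
    ClearedFormalEquation n (taylorSeriesWithin H T) (taylorSeriesWithin γ S) := by
  have hp := hγ.derivWithin_infty hS
  have hq := hp.derivWithin_infty hS
  have hHγ : ContDiffOn ℝ ∞ (fun s => H (γ s)) S := hH.comp hγ hmaps
  have hid : ContDiffOn ℝ ∞ (fun s : ℝ => s) S := contDiffOn_id
  obtain ⟨G, hG⟩ : ∃ G : ℝ → ℝ, G = fun s => H (γ s) := ⟨_, rfl⟩
  have hGs := taylorSeriesWithin_comp hS h0 hT hγ hH hmaps hγ0
  rw [← hG] at hHγ hGs
  -- The equation is rewritten with sums and products only, and with the composite `H ∘ γ` kept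
  -- opaque as `G`, so that the sum and product rules take it apart completely.
  have hz : taylorSeriesWithin (fun s =>
      (1 + 4 * (s * s) * (derivWithin γ S s * derivWithin γ S s)) *
        ((1 + (-2 * (n : ℝ)) * s) * derivWithin γ S s + (-1) * G s)
      + 4 * (s * derivWithin γ S s + (s * s) * derivWithin (derivWithin γ S) S s)) S = 0 := by
    rw [taylorSeriesWithin_congr h0 (g := fun _ => (0 : ℝ)), taylorSeriesWithin_const, map_zero]
    intro s hs
    have := heq s hs
    simp only [hG]
    linear_combination this
  have hc : ∀ c : ℝ, ContDiffOn ℝ ∞ (fun _ : ℝ => c) S := fun c => contDiffOn_const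
  rw [taylorSeriesWithin_add hS h0 (by fun_prop) (by fun_prop),
    taylorSeriesWithin_mul hS h0 (by fun_prop) (by fun_prop),
    taylorSeriesWithin_add hS h0 (by fun_prop) (by fun_prop),
    taylorSeriesWithin_mul hS h0 (by fun_prop) (by fun_prop),
    taylorSeriesWithin_mul hS h0 (by fun_prop) (by fun_prop),
    taylorSeriesWithin_mul hS h0 (by fun_prop) (by fun_prop),
    taylorSeriesWithin_mul hS h0 (by fun_prop) (by fun_prop),
    taylorSeriesWithin_add hS h0 (by fun_prop) (by fun_prop),
    taylorSeriesWithin_mul hS h0 (by fun_prop) (by fun_prop),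
    taylorSeriesWithin_add hS h0 (by fun_prop) (by fun_prop),
    taylorSeriesWithin_mul hS h0 (by fun_prop) (by fun_prop),
    taylorSeriesWithin_mul hS h0 (by fun_prop) (by fun_prop),
    taylorSeriesWithin_mul hS h0 (by fun_prop) (by fun_prop),
    taylorSeriesWithin_mul hS h0 (by fun_prop) (by fun_prop),
    taylorSeriesWithin_add hS h0 (by fun_prop) (by fun_prop),
    taylorSeriesWithin_mul hS h0 (by fun_prop) (by fun_prop),
    taylorSeriesWithin_mul hS h0 (by fun_prop) (by fun_prop),
    taylorSeriesWithin_mul hS h0 (by fun_prop) (by fun_prop),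
    hGs, taylorSeriesWithin_id hS h0] at hz
  simp only [taylorSeriesWithin_const, ← derivative_taylorSeriesWithin, map_neg, map_one,
    map_natCast, map_ofNat] at hz
  unfold ClearedFormalEquation
  linear_combination hz

end Taylor

/-! ### Regularity at the irregular singular point -/

section Singular

/-- The exponent is `s⁻¹ (-1/4 + c s log s)` and `s log s → 0`: the essential singularity beats
every power `s ^ c`. -/
lemma tendsto_exp_neg_inv_add_log (c : ℝ) :
    Tendsto (fun s : ℝ => Real.exp (-(1 / (4 * s)) + c * Real.log s)) (𝓝[>] 0) (𝓝 0) := by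
  rw [Real.tendsto_exp_comp_nhds_zero]
  have h1 : Tendsto (fun s : ℝ => -(1 / 4) + c * (Real.log s * s)) (𝓝[>] 0)
      (𝓝 (-(1 / 4) + c * 0)) :=
    ((by simpa only [Real.rpow_one] using tendsto_log_mul_rpow_nhdsGT_zero zero_lt_one :
      Tendsto (fun s : ℝ => Real.log s * s) (𝓝[>] 0) (𝓝 0)).const_mul c).const_add _
  have h2 : Tendsto (fun s : ℝ => s⁻¹ * (-(1 / 4) + c * (Real.log s * s))) (𝓝[>] 0) atBot :=
    tendsto_inv_nhdsGT_zero.atTop_mul_neg (by norm_num) h1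
  refine h2.congr' ?_
  filter_upwards [self_mem_nhdsWithin] with s hs
  have : (0 : ℝ) < s := hs
  field_simp

/-- A solution of `4 s² v' + (1 + b s) v = g` of at most polynomial growth at the irregular
singular point `0` converges there to the limit of `g`. -/
lemma tendsto_of_singular_ode {v v' g : ℝ → ℝ} {b g₀ K : ℝ}
    (hv : ∀ᶠ s in 𝓝[>] (0 : ℝ), HasDerivAt v (v' s) s)
    (heq : ∀ᶠ s in 𝓝[>] (0 : ℝ), 4 * s ^ 2 * v' s + (1 + b * s) * v s = g s)
    (hbd : ∀ᶠ s in 𝓝[>] (0 : ℝ), |s ^ 2 * v s| ≤ K)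
    (hg : Tendsto g (𝓝[>] 0) (𝓝 g₀)) : Tendsto v (𝓝[>] 0) (𝓝 g₀) := by
  have hpos : ∀ᶠ s in 𝓝[>] (0 : ℝ), 0 < s := self_mem_nhdsWithin
  have hlin : Tendsto (fun s : ℝ => 1 + b * s) (𝓝[>] 0) (𝓝 1) := by
    have : Tendsto (fun s : ℝ => 1 + b * s) (𝓝 0) (𝓝 (1 + b * 0)) := by
      apply Continuous.tendsto; fun_prop
    simpa using this.mono_left nhdsWithin_le_nhds
  have hlinpos : ∀ᶠ s in 𝓝[>] (0 : ℝ), 0 < 1 + b * s := hlin.eventually (lt_mem_nhds one_pos)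
  -- The integrating factor `exp(-1/(4s)) s^(b/4)`. L'Hôpital applied to `(μ v) / μ` gives the
  -- quotient of derivatives `g / (1 + b s)`; the growth bound on `v` serves only to make `μ v` tend
  -- to `0`.
  set μ : ℝ → ℝ := fun s => Real.exp (-(1 / (4 * s)) + b / 4 * Real.log s) with hμ
  have hμ' : ∀ s : ℝ, 0 < s → HasDerivAt μ (μ s * ((1 + b * s) / (4 * s ^ 2))) s := by
    intro s hs
    have h1 : HasDerivAt (fun s : ℝ => -(1 / (4 * s)) + b / 4 * Real.log s)
        ((1 + b * s) / (4 * s ^ 2)) s := by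
      have h2 := ((((hasDerivAt_id s).const_mul 4).inv (by simpa using hs.ne')).neg).add
        ((Real.hasDerivAt_log hs.ne').const_mul (b / 4))
      refine (h2.congr_deriv ?_).congr_of_eventuallyEq ?_
      · simp only [id]; field_simp
      · exact Eventually.of_forall fun x => by simp [one_div]
    exact h1.exp
  have key : Tendsto (fun s => (μ s * v s) / μ s) (𝓝[>] 0) (𝓝 g₀) := by
    refine HasDerivAt.lhopital_zero_nhdsGT
      (f' := fun s => μ s * ((1 + b * s) / (4 * s ^ 2)) * v s + μ s * v' s)
      (g' := fun s => μ s * ((1 + b * s) / (4 * s ^ 2))) ?_ ?_ ?_ ?_ ?_ ?_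
    · filter_upwards [hv, hpos] with s h1 h2
      exact (hμ' s h2).mul h1
    · filter_upwards [hpos] with s h2
      exact hμ' s h2
    · filter_upwards [hpos, hlinpos] with s h1 h2
      have : 0 < μ s := Real.exp_pos _
      positivity
    · have h1 := tendsto_exp_neg_inv_add_log (b / 4 - 2)
      have h2 : Tendsto (fun s : ℝ => Real.exp (-(1 / (4 * s)) + (b / 4 - 2) * Real.log s) * K)
          (𝓝[>] 0) (𝓝 0) := by simpa using h1.mul_const K
      refine squeeze_zero_norm' ?_ h2
      filter_upwards [hbd, hpos] with s h3 h4
      have h5 : μ s = Real.exp (-(1 / (4 * s)) + (b / 4 - 2) * Real.log s) * s ^ 2 := by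
        have : s ^ 2 = Real.exp (2 * Real.log s) := by
          rw [mul_comm, Real.exp_mul, Real.exp_log h4]; norm_cast
        rw [this, ← Real.exp_add]
        simp only [hμ]; congr 1; ring
      rw [h5, Real.norm_eq_abs, mul_assoc, abs_mul, abs_of_pos (Real.exp_pos _)]
      gcongr
    · exact tendsto_exp_neg_inv_add_log (b / 4)
    · have h1 : Tendsto (fun s => g s / (1 + b * s)) (𝓝[>] 0) (𝓝 g₀) := by
        have := hg.div hlin one_ne_zero
        rwa [div_one] at this
      refine h1.congr' ?_
      filter_upwards [hpos, hlinpos, heq] with s h2 h3 h4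
      have : 0 < μ s := Real.exp_pos _
      rw [← h4]
      field_simp
      ring
  refine key.congr' ?_
  filter_upwards with s
  have : 0 < μ s := Real.exp_pos _
  field_simp

/-- Smoothness up to the irregular singular point `0` of continuous solutions
of `4 s² u' + (1 + a s) u = f`. -/
lemma contDiffOn_of_singular_ode {s₀ : ℝ} (hs₀ : 0 < s₀) (k : ℕ) {a : ℝ} {u u' f : ℝ → ℝ}
    (hu : ContinuousOn u (Icc 0 s₀))
    (hu' : ∀ s ∈ Ioc 0 s₀, HasDerivWithinAt u (u' s) (Icc 0 s₀) s)
    (heq : ∀ s ∈ Ioc 0 s₀, 4 * s ^ 2 * u' s + (1 + a * s) * u s = f s)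
    (hf : ContDiffOn ℝ k f (Icc 0 s₀)) : ContDiffOn ℝ k u (Icc 0 s₀) := by
  have hI : UniqueDiffOn ℝ (Icc 0 s₀) := uniqueDiffOn_Icc hs₀
  induction k generalizing a u u' f with
  | zero => exact contDiffOn_zero.2 hu
  | succ k ih =>
    have hf' := hf
    rw [Nat.cast_succ, contDiffOn_succ_iff_derivWithin hI] at hf'
    obtain ⟨hfd, -, hfk⟩ := hf'
    have huk : ContDiffOn ℝ k u (Icc 0 s₀) :=
      ih hu hu' heq (hf.of_le (by exact_mod_cast Nat.le_succ k))
    -- Differentiating the equation gives `4 s² v' + (1 + (a + 8) s) v = f' - a u` for `v = u'`, the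
    -- `8 s` coming from the derivative of `4 s²`. At `s = 0` this forces `v = g 0`, which is the
    -- value assigned to `v` there.
    set g : ℝ → ℝ := fun s => derivWithin f (Icc 0 s₀) s - a * u s with hg
    have hgk : ContDiffOn ℝ k g (Icc 0 s₀) := hfk.sub (contDiffOn_const.mul huk)
    set w : ℝ → ℝ := fun s => (f s - (1 + a * s) * u s) / (4 * s ^ 2) with hw
    set v : ℝ → ℝ := fun s => if s = 0 then g 0 else w s with hv
    have hvw : ∀ s, 0 < s → v s = w s := fun s hs => by simp [hv, hs.ne']
    have hvu : ∀ s ∈ Ioc 0 s₀, v s = u' s := by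
      intro s hs
      have h0 : 0 < s := hs.1
      rw [hvw s h0, hw]
      simp only
      rw [← heq s hs]
      field_simp
      ring
    have hwd : ∀ s ∈ Ioc 0 s₀, HasDerivWithinAt w ((g s - (1 + (a + 8) * s) * v s) / (4 * s ^ 2))
        (Icc 0 s₀) s := by
      intro s hs
      have h0 : 0 < s := hs.1
      have h1 := (hfd s (Ioc_subset_Icc_self hs)).hasDerivWithinAt
      have h2 : HasDerivWithinAt (fun s => 1 + a * s) a (Icc 0 s₀) s := by
        simpa using ((hasDerivWithinAt_id s (Icc 0 s₀)).const_mul a).const_add 1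
      have h3 : HasDerivWithinAt (fun s : ℝ => 4 * s ^ 2) (8 * s) (Icc 0 s₀) s := by
        have := ((hasDerivAt_pow 2 s).const_mul 4).hasDerivWithinAt (s := Icc 0 s₀)
        refine this.congr_deriv ?_
        norm_num; ring
      have h4 := (h1.sub (h2.mul (hu' s hs))).div h3 (by positivity)
      refine h4.congr_deriv ?_
      have h5 : f s - (1 + a * s) * u s = 4 * s ^ 2 * u' s := by rw [← heq s hs]; ring
      simp only [Pi.sub_apply, Pi.mul_apply, h5, hvu s hs, hg]
      field_simp
      ring
    have hvd : ∀ s ∈ Ioc 0 s₀, HasDerivWithinAt v ((g s - (1 + (a + 8) * s) * v s) / (4 * s ^ 2))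
        (Icc 0 s₀) s := by
      intro s hs
      refine (hwd s hs).congr_of_eventuallyEq ?_ (hvw s hs.1)
      filter_upwards [mem_nhdsWithin_of_mem_nhds (lt_mem_nhds hs.1)] with t ht using hvw t ht
    have hIoo : ∀ᶠ s in 𝓝[>] (0 : ℝ), s ∈ Ioo 0 s₀ := Ioo_mem_nhdsGT hs₀
    -- Solving the original equation for `u'` bounds `s² v`, which is the polynomial growth needed
    -- for the limit.
    have hlim : Tendsto v (𝓝[>] 0) (𝓝 (g 0)) := by
      obtain ⟨K, hK⟩ := isCompact_Icc.exists_bound_of_continuousOn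
        (f := fun s => f s - (1 + a * s) * u s)
        (hf.continuousOn.sub ((by fun_prop : Continuous fun s => 1 + a * s).continuousOn.mul hu))
      refine tendsto_of_singular_ode (b := a + 8) (g := g) (K := K / 4)
        (v' := fun s => (g s - (1 + (a + 8) * s) * v s) / (4 * s ^ 2)) ?_ ?_ ?_ ?_
      · filter_upwards [hIoo] with s hs
        exact (hvd s (Ioo_subset_Ioc_self hs)).hasDerivAt (Icc_mem_nhds hs.1 hs.2)
      · filter_upwards [hIoo] with s hs
        have : 0 < s := hs.1
        field_simp
        ring
      · filter_upwards [hIoo] with s hs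
        have h0 : 0 < s := hs.1
        have h1 := hK s (Ioo_subset_Icc_self hs)
        rw [hvw s h0, hw]
        simp only
        rw [show s ^ 2 * ((f s - (1 + a * s) * u s) / (4 * s ^ 2))
          = (f s - (1 + a * s) * u s) / 4 by field_simp, abs_div]
        rw [Real.norm_eq_abs] at h1
        rw [abs_of_pos (by norm_num : (0 : ℝ) < 4)]
        linarith
      · have := hgk.continuousOn 0 (left_mem_Icc.2 hs₀.le)
        rw [ContinuousWithinAt] at this
        refine this.mono_left ?_
        rw [nhdsWithin_Icc_eq_nhdsGE hs₀]
        exact nhdsWithin_mono _ Ioi_subset_Ici_self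
    have hvc : ContinuousOn v (Icc 0 s₀) := by
      intro s hs
      rcases hs.1.eq_or_lt with h | h
      · subst h
        have : ContinuousWithinAt v (Ioi 0) 0 := by
          have : v 0 = g 0 := by simp [hv]
          rw [ContinuousWithinAt, this]; exact hlim
        exact (continuousWithinAt_Ioi_iff_Ici.1 this).mono Icc_subset_Ici_self
      · exact (hvd s ⟨h, hs.2⟩).continuousWithinAt
    have hud : ∀ s ∈ Icc 0 s₀, HasDerivWithinAt u (v s) (Icc 0 s₀) s := by
      intro s hs
      rcases hs.1.eq_or_lt with h | h
      · subst h
        have hd : ∀ t ∈ Ioo 0 s₀, HasDerivAt u (v t) t := fun t ht => by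
          rw [hvu t (Ioo_subset_Ioc_self ht)]
          exact (hu' t (Ioo_subset_Ioc_self ht)).hasDerivAt (Icc_mem_nhds ht.1 ht.2)
        refine (hasDerivWithinAt_Ici_of_tendsto_deriv (s := Ioo 0 s₀)
          (fun t ht => (hd t ht).differentiableAt.differentiableWithinAt)
          ((hu 0 hs).mono Ioo_subset_Icc_self) (Ioo_mem_nhdsGT hs₀) ?_).mono Icc_subset_Ici_self
        have : v 0 = g 0 := by simp [hv]
        rw [this]
        refine hlim.congr' ?_
        filter_upwards [hIoo] with t ht using (hd t ht).deriv.symm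
      · rw [hvu s ⟨h, hs.2⟩]; exact hu' s ⟨h, hs.2⟩
    have hvk : ContDiffOn ℝ k v (Icc 0 s₀) := by
      refine ih (a := a + 8) (f := g) hvc hvd ?_ hgk
      intro s hs
      have : 0 < s := hs.1
      field_simp
      ring
    rw [Nat.cast_succ, contDiffOn_succ_iff_derivWithin hI]
    refine ⟨fun s hs => (hud s hs).differentiableWithinAt, by simp, ?_⟩
    exact hvk.congr fun s hs => (hud s hs).derivWithin (hI s hs)

/-- Smoothness of solutions of the nonlinear equation, by bootstrapping. -/
lemma contDiffOn_of_nonlinear_singular_ode {n : ℕ} {H γ p p' : ℝ → ℝ} {d₀ s₀ : ℝ} (hs₀ : 0 < s₀)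
    (hH : ContDiffOn ℝ ∞ H (Ico 0 d₀)) (hmaps : MapsTo γ (Icc 0 s₀) (Ico 0 d₀))
    (hγ : ∀ s ∈ Icc 0 s₀, HasDerivWithinAt γ (p s) (Icc 0 s₀) s)
    (hp : ContinuousOn p (Icc 0 s₀))
    (hp0 : p 0 = H (γ 0))
    (hp' : ∀ s ∈ Ioc 0 s₀, HasDerivWithinAt p (p' s) (Icc 0 s₀) s)
    (heq : ∀ s ∈ Ioc 0 s₀, 4 * s ^ 2 * p' s + 4 * s * p s
      + (1 + 4 * s ^ 2 * p s ^ 2) * ((1 - 2 * (n : ℝ) * s) * p s - H (γ s)) = 0) :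
    ContDiffOn ℝ ∞ γ (Icc 0 s₀) := by
  have hI : UniqueDiffOn ℝ (Icc 0 s₀) := uniqueDiffOn_Icc hs₀
  have hγsucc : ∀ k : ℕ, ContDiffOn ℝ k p (Icc 0 s₀) → ContDiffOn ℝ (k + 1 : ℕ) γ (Icc 0 s₀) := by
    intro k hk
    rw [Nat.cast_succ, contDiffOn_succ_iff_derivWithin hI]
    refine ⟨fun s hs => (hγ s hs).differentiableWithinAt, by simp, ?_⟩
    exact hk.congr fun s hs => (hγ s hs).derivWithin (hI s hs)
  have hpk : ∀ k : ℕ, ContDiffOn ℝ k p (Icc 0 s₀) := by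
    intro k
    induction k with
    | zero => exact contDiffOn_zero.2 hp
    | succ k ih =>
      have hγk := hγsucc k ih
      have hHk : ContDiffOn ℝ (k + 1 : ℕ) (fun s => H (γ s)) (Icc 0 s₀) :=
        (hH.of_le (by exact_mod_cast le_top)).comp hγk hmaps
      have hHk' : ContDiffOn ℝ k (fun s => H (γ s)) (Icc 0 s₀) :=
        hHk.of_le (by exact_mod_cast Nat.le_succ k)
      set F : ℝ → ℝ := fun s => -(4 * s * p s)
        - (1 + 4 * s ^ 2 * p s ^ 2) * ((1 - 2 * (n : ℝ) * s) * p s - H (γ s)) with hF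
      have hFk : ContDiffOn ℝ k F (Icc 0 s₀) := by
        obtain ⟨G, hG⟩ : ∃ G : ℝ → ℝ, G = fun s => H (γ s) := ⟨_, rfl⟩
        rw [← hG] at hHk'
        have hFG : F = fun s => -(4 * s * p s)
          - (1 + 4 * s ^ 2 * p s ^ 2) * ((1 - 2 * (n : ℝ) * s) * p s - G s) := by rw [hF, hG]
        rw [hFG]
        fun_prop
      -- The key gain: `s² p ^ j` is one order smoother than `p`, because in its derivative `s² p'`
      -- may be replaced by `F / 4`. At `s = 0`, where `p'` is not available, the slope is `s p ^ j
      -- → 0`, and the formula agrees since `hp0` gives `F 0 = 0`.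
      have hyd : ∀ j : ℕ, ∀ s ∈ Icc 0 s₀, HasDerivWithinAt (fun s => s ^ 2 * p s ^ j)
          (2 * s * p s ^ j + j * p s ^ (j - 1) * (F s / 4)) (Icc 0 s₀) s := by
        intro j s hs
        rcases hs.1.eq_or_lt with h | h
        · subst h
          have h1 : HasDerivWithinAt (fun s => s ^ 2 * p s ^ j) (0 : ℝ) (Icc 0 s₀) 0 := by
            rw [hasDerivWithinAt_iff_tendsto_slope]
            have h2 : Tendsto (fun s => s * p s ^ j) (𝓝[Icc 0 s₀ \ {0}] 0) (𝓝 (0 * p 0 ^ j)) := by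
              have : ContinuousWithinAt (fun s => s * p s ^ j) (Icc 0 s₀) 0 :=
                continuousWithinAt_id.mul ((hp 0 hs).pow j)
              exact this.tendsto.mono_left (nhdsWithin_mono _ sdiff_subset)
            rw [zero_mul] at h2
            refine h2.congr' ?_
            filter_upwards [self_mem_nhdsWithin] with t ht
            have : t ≠ 0 := ht.2
            simp only [slope_def_field]
            field_simp
            ring
          refine h1.congr_deriv ?_
          simp [hF, hp0]
        · have h1 := ((hasDerivAt_pow 2 s).hasDerivWithinAt (s := Icc 0 s₀)).mul
            ((hp' s ⟨h, hs.2⟩).pow j)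
          refine h1.congr_deriv ?_
          have := heq s ⟨h, hs.2⟩
          simp only [hF]
          push_cast
          simp only [Pi.pow_apply]
          linear_combination (j * p s ^ (j - 1)) * this / 4
      have hyk : ∀ j : ℕ, ContDiffOn ℝ (k + 1 : ℕ) (fun s => s ^ 2 * p s ^ j) (Icc 0 s₀) := by
        intro j
        rw [Nat.cast_succ, contDiffOn_succ_iff_derivWithin hI]
        refine ⟨fun s hs => (hyd j s hs).differentiableWithinAt, by simp, ?_⟩
        refine ContDiffOn.congr ?_ fun s hs => (hyd j s hs).derivWithin (hI s hs)
        fun_prop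
      -- All nonlinear terms in `p` carry a factor `s²` and so go into the smoother right-hand side;
      -- the terms linear in `p` give `a = 4 - 2 n`.
      refine contDiffOn_of_singular_ode (a := 4 - 2 * n) hs₀ (k + 1) (u' := p')
        (f := fun s => H (γ s) + 4 * (s ^ 2 * p s ^ 2) * H (γ s)
          - 4 * (s ^ 2 * p s ^ 3) * (1 - 2 * (n : ℝ) * s)) hp hp' ?_ ?_
      · intro s hs
        linear_combination heq s hs
      · refine (hHk.add ((contDiffOn_const.mul (hyk 2)).mul hHk)).sub
          ((contDiffOn_const.mul (hyk 3)).mul ?_)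
        fun_prop
  exact contDiffOn_infty.2 fun k => (hγsucc k (hpk k)).of_le (by exact_mod_cast Nat.le_succ k)

end Singular

/-! ### The bounded solution operator of `4 s² u' + u = f` -/

section SingularMean

/-- The kernel of the bounded solution operator of `4 s² u' + u = f`. -/
noncomputable def singularKernel : ℝ → ℝ := deriv fun s => expNegInvGlue (4 * s)

lemma contDiff_expNegInvGlue_four_mul : ContDiff ℝ 1 fun s => expNegInvGlue (4 * s) :=
  (expNegInvGlue.contDiff (n := 1)).comp (by fun_prop)

lemma hasDerivAt_expNegInvGlue_four_mul (s : ℝ) :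
    HasDerivAt (fun s => expNegInvGlue (4 * s)) (singularKernel s) s :=
  (contDiff_expNegInvGlue_four_mul.differentiable one_ne_zero s).hasDerivAt

lemma continuous_singularKernel : Continuous singularKernel :=
  contDiff_expNegInvGlue_four_mul.continuous_deriv le_rfl

lemma singularKernel_nonneg (s : ℝ) : 0 ≤ singularKernel s := by
  refine Monotone.deriv_nonneg fun x y h => expNegInvGlue.monotone ?_
  linarith

/-- The total weight, by which `singularMean` is normalized. -/
lemma integral_singularKernel (s : ℝ) :
    ∫ t in (0 : ℝ)..s, singularKernel t = expNegInvGlue (4 * s) := by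
  rw [intervalIntegral.integral_eq_sub_of_hasDerivAt
    (fun t _ => hasDerivAt_expNegInvGlue_four_mul t)
    (continuous_singularKernel.intervalIntegrable _ _)]
  simp

lemma singularKernel_of_pos {s : ℝ} (hs : 0 < s) :
    singularKernel s = expNegInvGlue (4 * s) / (4 * s ^ 2) := by
  have h1 : HasDerivAt (fun s : ℝ => Real.exp (-(4 * s)⁻¹))
      (Real.exp (-(4 * s)⁻¹) * (1 / (4 * s ^ 2))) s := by
    have h2 := (((hasDerivAt_id s).const_mul 4).inv (by simpa using hs.ne')).neg
    refine HasDerivAt.exp (h2.congr_deriv ?_)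
    simp only [id]
    field_simp
  have h3 : (fun s : ℝ => expNegInvGlue (4 * s)) =ᶠ[𝓝 s] fun s => Real.exp (-(4 * s)⁻¹) := by
    filter_upwards [lt_mem_nhds hs] with t ht
    have h4 : ¬ 4 * t ≤ 0 := by linarith
    simp only [expNegInvGlue, h4, if_false]
  rw [(hasDerivAt_expNegInvGlue_four_mul s).unique (h1.congr_of_eventuallyEq h3), h3.eq_of_nhds]
  ring

/-- The bounded solution of `4 s² u' + u = f`, as a weighted mean of `f`. -/
noncomputable def singularMean (f : ℝ → ℝ) (s : ℝ) : ℝ :=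
  if s ≤ 0 then f 0 else (∫ t in (0 : ℝ)..s, singularKernel t * f t) / expNegInvGlue (4 * s)

lemma singularMean_zero (f : ℝ → ℝ) : singularMean f 0 = f 0 := by simp [singularMean]

lemma singularMean_sub {f g : ℝ → ℝ} (hf : Continuous f) (hg : Continuous g) (s : ℝ) :
    singularMean (fun t => f t - g t) s = singularMean f s - singularMean g s := by
  unfold singularMean
  split_ifs
  · rfl
  · rw [← sub_div, ← intervalIntegral.integral_sub
      (f := fun t => singularKernel t * f t) (g := fun t => singularKernel t * g t)
      ((continuous_singularKernel.mul hf).intervalIntegrable _ _)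
      ((continuous_singularKernel.mul hg).intervalIntegrable _ _)]
    simp only [mul_sub]

lemma singularMean_le {f : ℝ → ℝ} (hf : Continuous f) {s M : ℝ} (hs : 0 ≤ s)
    (h : ∀ t ∈ Icc 0 s, f t ≤ M) : singularMean f s ≤ M := by
  unfold singularMean
  split_ifs with h0
  · exact h 0 ⟨le_rfl, hs⟩
  · have hpos : 0 < expNegInvGlue (4 * s) := expNegInvGlue.pos_of_pos (by linarith)
    rw [div_le_iff₀ hpos, ← integral_singularKernel, ← intervalIntegral.integral_const_mul]
    refine intervalIntegral.integral_mono_on hs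
      ((continuous_singularKernel.mul hf).intervalIntegrable _ _)
      ((continuous_singularKernel.const_smul M).intervalIntegrable _ _) fun t ht => ?_
    rw [mul_comm]
    exact mul_le_mul_of_nonneg_right (h t ht) (singularKernel_nonneg t)

lemma le_singularMean {f : ℝ → ℝ} (hf : Continuous f) {s M : ℝ} (hs : 0 ≤ s)
    (h : ∀ t ∈ Icc 0 s, M ≤ f t) : M ≤ singularMean f s := by
  have h1 := singularMean_le (f := fun t => 0 - f t) (by fun_prop) (M := -M) hs
    fun t ht => by linarith [h t ht]
  rw [singularMean_sub continuous_const hf] at h1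
  have h2 : singularMean (fun _ => (0 : ℝ)) s = 0 := by simp [singularMean]
  linarith

lemma abs_singularMean_sub_le {f g : ℝ → ℝ} (hf : Continuous f) (hg : Continuous g) {s M : ℝ}
    (hs : 0 ≤ s) (h : ∀ t ∈ Icc 0 s, |f t - g t| ≤ M) :
    |singularMean f s - singularMean g s| ≤ M := by
  rw [← singularMean_sub hf hg, abs_le]
  exact ⟨le_singularMean (hf.sub hg) hs fun t ht => (abs_le.1 (h t ht)).1,
    singularMean_le (hf.sub hg) hs fun t ht => (abs_le.1 (h t ht)).2⟩

/-- The quotient rule, where the logarithmic derivative of the normalizing factor `exp(-1/(4s))` is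
`1 / (4 s²)`. -/
lemma hasDerivAt_singularMean {f : ℝ → ℝ} (hf : Continuous f) {s : ℝ} (hs : 0 < s) :
    HasDerivAt (singularMean f) ((f s - singularMean f s) / (4 * s ^ 2)) s := by
  have hpos : 0 < expNegInvGlue (4 * s) := expNegInvGlue.pos_of_pos (by linarith)
  have h1 := (((continuous_singularKernel.mul hf).integral_hasStrictDerivAt 0 s).hasDerivAt).div
    (hasDerivAt_expNegInvGlue_four_mul s) hpos.ne'
  refine (h1.congr_deriv ?_).congr_of_eventuallyEq ?_
  · simp only [singularMean, hs.not_ge, if_false, singularKernel_of_pos hs]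
    simp only [Pi.mul_apply, singularKernel_of_pos hs]
    field_simp
  · filter_upwards [lt_mem_nhds hs] with t ht
    simp [singularMean, ht.not_ge]

/-- At `0` a mean over `[0, x]` lies between the bounds of `f` there, which close in on `f 0`. -/
lemma continuousOn_singularMean {f : ℝ → ℝ} (hf : Continuous f) :
    ContinuousOn (singularMean f) (Ici 0) := by
  intro s hs
  rcases (mem_Ici.1 hs).eq_or_lt with h | h
  · subst h
    rw [Metric.continuousWithinAt_iff]
    intro ε hε
    obtain ⟨δ, hδ, h⟩ := Metric.continuous_iff.1 hf 0 (ε / 2) (by positivity)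
    refine ⟨δ, hδ, fun {x} hx hxd => ?_⟩
    have h0 : (0 : ℝ) ≤ x := hx
    rw [Real.dist_eq, sub_zero, abs_of_nonneg h0] at hxd
    rw [Real.dist_eq, singularMean_zero]
    have h1 : ∀ t ∈ Icc 0 x, |f t - f 0| ≤ ε / 2 := fun t ht => by
      rw [← Real.dist_eq]
      refine (h t ?_).le
      rw [Real.dist_eq, sub_zero, abs_of_nonneg ht.1]
      exact ht.2.trans_lt hxd
    have h2 : |singularMean f x - f 0| ≤ ε / 2 := by
      rw [abs_le]
      constructor
      · have := le_singularMean hf h0 (M := f 0 - ε / 2)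
          fun t ht => by linarith [(abs_le.1 (h1 t ht)).1]
        linarith
      · have := singularMean_le hf h0 (M := f 0 + ε / 2)
          fun t ht => by linarith [(abs_le.1 (h1 t ht)).2]
        linarith
    linarith
  · exact (hasDerivAt_singularMean hf h).continuousAt.continuousWithinAt

end SingularMean

/-! ### Existence by contraction -/

section Existence

/-- The contraction principle for operators on continuous functions on `[0, s₀]` with values in
`[a, b]`. -/
lemma exists_eqOn_of_contracting {s₀ a b : ℝ} (hs₀ : 0 ≤ s₀) (hab : a ≤ b)
    (Φ : (ℝ → ℝ) → ℝ → ℝ)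
    (hcont : ∀ P : ℝ → ℝ, Continuous P → (∀ s, P s ∈ Icc a b) → ContinuousOn (Φ P) (Icc 0 s₀))
    (hmaps : ∀ P : ℝ → ℝ, Continuous P → (∀ s, P s ∈ Icc a b) →
      ∀ s ∈ Icc 0 s₀, Φ P s ∈ Icc a b)
    (hlip : ∀ P Q : ℝ → ℝ, Continuous P → (∀ s, P s ∈ Icc a b) → Continuous Q →
      (∀ s, Q s ∈ Icc a b) → ∀ D : ℝ, (∀ s ∈ Icc 0 s₀, |P s - Q s| ≤ D) →
      ∀ s ∈ Icc 0 s₀, |Φ P s - Φ Q s| ≤ D / 2) :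
    ∃ P : ℝ → ℝ, Continuous P ∧ (∀ s, P s ∈ Icc a b) ∧ EqOn (Φ P) P (Icc 0 s₀) := by
  -- Banach's theorem runs in the complete space of continuous maps `[0, s₀] → [a, b]`; constant
  -- extension beyond the endpoints feeds them to `Φ`, which takes functions on the line.
  let ext : C(Icc 0 s₀, Icc a b) → ℝ → ℝ := fun p => IccExtend hs₀ fun s => (p s : ℝ)
  have hext : ∀ p, Continuous (ext p) := fun p =>
    Continuous.Icc_extend' (continuous_subtype_val.comp p.continuous)
  have hmem : ∀ p s, ext p s ∈ Icc a b := fun p s => (p _).2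
  let T : C(Icc 0 s₀, Icc a b) → C(Icc 0 s₀, Icc a b) := fun p =>
    ⟨fun s => ⟨Φ (ext p) s, hmaps _ (hext p) (hmem p) s s.2⟩,
      (hcont _ (hext p) (hmem p)).domRestrict.subtype_mk _⟩
  have hT : ContractingWith (1 / 2) T := by
    refine ⟨by norm_num, LipschitzWith.of_dist_le_mul fun p q => ?_⟩
    rw [ContinuousMap.dist_le (by positivity)]
    intro s
    have := hlip _ _ (hext p) (hmem p) (hext q) (hmem q) (dist p q) (fun t ht => by
      have := ContinuousMap.dist_apply_le_dist (f := p) (g := q) ⟨t, ht⟩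
      rw [Subtype.dist_eq, Real.dist_eq] at this
      simpa only [ext, IccExtend_of_mem hs₀ _ ht] using this) s s.2
    rw [Subtype.dist_eq, Real.dist_eq]
    refine this.trans (le_of_eq ?_)
    push_cast
    ring
  have : Nonempty C(Icc 0 s₀, Icc a b) := ⟨ContinuousMap.const _ ⟨a, le_rfl, hab⟩⟩
  refine ⟨ext (ContractingWith.fixedPoint T hT), hext _, hmem _, fun s hs => ?_⟩
  have hfix := hT.fixedPoint_isFixedPt
  have h1 := congrArg (fun p : C(Icc 0 s₀, Icc a b) => (p ⟨s, hs⟩ : ℝ)) hfix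
  simp only [ext, IccExtend_of_mem hs₀ _ hs]
  exact h1

/-- Existence of a solution of the singular initial value problem near `0`. -/
lemma exists_solution_near_zero (n : ℕ) {d₀ : ℝ} (hd₀ : 0 < d₀) {H : ℝ → ℝ}
    (hH : ContDiffOn ℝ ∞ H (Ico 0 d₀)) (hH0 : 0 < H 0) :
    ∃ s₀ : ℝ, 0 < s₀ ∧ ∃ γ p p' : ℝ → ℝ, γ 0 = 0 ∧ MapsTo γ (Icc 0 s₀) (Ico 0 d₀) ∧
      (∀ s ∈ Icc 0 s₀, HasDerivWithinAt γ (p s) (Icc 0 s₀) s) ∧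
      ContinuousOn p (Icc 0 s₀) ∧ p 0 = H (γ 0) ∧
      (∀ s ∈ Ioc 0 s₀, HasDerivWithinAt p (p' s) (Icc 0 s₀) s) ∧
      (∀ s ∈ Ioc 0 s₀, 4 * s ^ 2 * p' s + 4 * s * p s
        + (1 + 4 * s ^ 2 * p s ^ 2) * ((1 - 2 * (n : ℝ) * s) * p s - H (γ s)) = 0) ∧
      (∀ s ∈ Ioc 0 s₀, 0 < γ s) ∧ ∀ s ∈ Icc 0 s₀, 0 < p s := by
  set h := H 0 with hh
  set δ := d₀ / 2 with hδ
  have hδ0 : 0 < δ := by positivity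
  have hsub : Icc 0 δ ⊆ Ico 0 d₀ := fun x hx => ⟨hx.1, by linarith [hx.2]⟩
  obtain ⟨L, hL⟩ := (hH.mono hsub).exists_lipschitzOnWith (by simp) (convex_Icc 0 δ) isCompact_Icc
  have hL' : ∀ x ∈ Icc 0 δ, ∀ y ∈ Icc 0 δ, |H x - H y| ≤ L * |x - y| := fun x hx y hy => by
    simpa [Real.dist_eq] using hL.dist_le_mul x hx y hy
  set M : ℝ := h + L * δ with hM
  have hHM : ∀ x ∈ Icc 0 δ, |H x - h| ≤ L * x := fun x hx => by
    simpa [abs_of_nonneg hx.1] using hL' x hx 0 ⟨le_rfl, hδ0.le⟩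
  have hHbox : ∀ x ∈ Icc 0 δ, H x ∈ Icc (-M) M := fun x hx => by
    have h1 := abs_le.1 (hHM x hx)
    have h2 : (L : ℝ) * x ≤ L * δ := by gcongr; exact hx.2
    constructor <;> linarith [h1.1, h1.2]
  set G : ℝ × ℝ × ℝ → ℝ := fun z =>
    (2 * (n : ℝ) - 4) * z.2.2 + 4 * z.1 * z.2.2 ^ 2 * (z.2.1 - (1 - 2 * (n : ℝ) * z.1) * z.2.2)
    with hG
  have hGd : ContDiff ℝ 1 G := by fun_prop
  set box : Set (ℝ × ℝ × ℝ) := Icc 0 1 ×ˢ Icc (-M) M ×ˢ Icc (h / 2) (2 * h) with hbox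
  have hboxc : IsCompact box := isCompact_Icc.prod (isCompact_Icc.prod isCompact_Icc)
  obtain ⟨K, hK⟩ := hGd.contDiffOn.exists_lipschitzOnWith one_ne_zero
    ((convex_Icc 0 1).prod ((convex_Icc (-M) M).prod (convex_Icc (h / 2) (2 * h)))) hboxc
  obtain ⟨B, hB⟩ := hboxc.exists_bound_of_continuousOn hGd.continuous.continuousOn
  have small : ∀ c ε : ℝ, 0 < ε → ∀ᶠ s in 𝓝[>] (0 : ℝ), s * c ≤ ε := by
    intro c ε hε
    have h1 : Tendsto (fun s : ℝ => s * c) (𝓝[>] 0) (𝓝 (0 * c)) :=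
      ((by fun_prop : Continuous fun s : ℝ => s * c).tendsto 0).mono_left nhdsWithin_le_nhds
    rw [zero_mul] at h1
    exact (h1.eventually (gt_mem_nhds hε)).mono fun s hs => hs.le
  -- In order: `s` stays in the box on which `G` is bounded and Lipschitz; `∫ P` stays in `[0, δ]`,
  -- where `H` is Lipschitz; the right-hand side stays within `h / 2` of `h`; its Lipschitz constant
  -- in `P` is at most `1 / 2`.
  obtain ⟨s₀, hs₀, hs1, hs2, hs3, hs4⟩ : ∃ s₀ : ℝ, 0 < s₀ ∧ s₀ * 1 ≤ 1 ∧ s₀ * (2 * h) ≤ δ ∧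
      s₀ * (L * (2 * h) + B) ≤ h / 2 ∧ s₀ * (L + K * (L + 1)) ≤ 1 / 2 := by
    have hpos : ∀ᶠ s in 𝓝[>] (0 : ℝ), 0 < s := self_mem_nhdsWithin
    exact (hpos.and ((small _ _ one_pos).and ((small _ _ hδ0).and
      ((small _ _ (by positivity)).and (small _ _ (by norm_num)))))).exists
  set Γ : (ℝ → ℝ) → ℝ → ℝ := fun P s => ∫ t in (0 : ℝ)..s, P t with hΓ
  have hΓd : ∀ P : ℝ → ℝ, Continuous P → ∀ s, HasDerivAt (Γ P) (P s) s := fun P hP s =>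
    (hP.integral_hasStrictDerivAt 0 s).hasDerivAt
  have hΓlow : ∀ P : ℝ → ℝ, Continuous P → (∀ s, P s ∈ Icc (h / 2) (2 * h)) → ∀ s, 0 ≤ s →
      s * (h / 2) ≤ Γ P s := by
    intro P hP hPm s hs
    have := intervalIntegral.integral_mono_on (μ := MeasureTheory.volume)
      (f := fun _ => h / 2) (g := P) hs
      (continuous_const.intervalIntegrable _ _) (hP.intervalIntegrable _ _) fun t _ => (hPm t).1
    rwa [intervalIntegral.integral_const, smul_eq_mul, sub_zero] at this
  have hΓup : ∀ P : ℝ → ℝ, Continuous P → (∀ s, P s ∈ Icc (h / 2) (2 * h)) → ∀ s, 0 ≤ s →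
      Γ P s ≤ s * (2 * h) := by
    intro P hP hPm s hs
    have := intervalIntegral.integral_mono_on (μ := MeasureTheory.volume)
      (f := P) (g := fun _ => 2 * h) hs
      (hP.intervalIntegrable _ _) (continuous_const.intervalIntegrable _ _) fun t _ => (hPm t).2
    rwa [intervalIntegral.integral_const, smul_eq_mul, sub_zero] at this
  have hΓmem : ∀ P : ℝ → ℝ, Continuous P → (∀ s, P s ∈ Icc (h / 2) (2 * h)) →
      ∀ s ∈ Icc 0 s₀, Γ P s ∈ Icc 0 δ := by
    intro P hP hPm s hs
    have h0 := hs.1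
    refine ⟨le_trans (by positivity) (hΓlow P hP hPm s hs.1), (hΓup P hP hPm s hs.1).trans ?_⟩
    refine le_trans ?_ hs2
    gcongr
    exact hs.2
  have hΓlip : ∀ P Q : ℝ → ℝ, Continuous P → Continuous Q → ∀ D : ℝ,
      (∀ s ∈ Icc 0 s₀, |P s - Q s| ≤ D) → ∀ s ∈ Icc 0 s₀, |Γ P s - Γ Q s| ≤ D * s₀ := by
    intro P Q hP hQ D hD s hs
    have hD0 : 0 ≤ D := (abs_nonneg _).trans (hD s hs)
    simp only [hΓ]
    rw [← intervalIntegral.integral_sub (hP.intervalIntegrable _ _) (hQ.intervalIntegrable _ _)]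
    have := intervalIntegral.norm_integral_le_of_norm_le_const (a := 0) (b := s)
      (f := fun t => P t - Q t) (C := D) (fun t ht => by
        rw [uIoc_of_le hs.1] at ht
        exact hD t ⟨ht.1.le, ht.2.trans hs.2⟩)
    refine this.trans ?_
    rw [sub_zero, abs_of_nonneg hs.1]
    gcongr
    exact hs.2
  set F : (ℝ → ℝ) → ℝ → ℝ := fun P s => H (Γ P s) + s * G (s, H (Γ P s), P s) with hF
  have hFc : ∀ P : ℝ → ℝ, Continuous P → (∀ s, P s ∈ Icc (h / 2) (2 * h)) →
      ContinuousOn (F P) (Icc 0 s₀) := by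
    intro P hP hPm
    have h1 : ContinuousOn (Γ P) (Icc 0 s₀) := fun s _ =>
      (hΓd P hP s).continuousAt.continuousWithinAt
    have h2 : ContinuousOn (fun s => H (Γ P s)) (Icc 0 s₀) :=
      (hH.continuousOn.mono hsub).comp h1 (hΓmem P hP hPm)
    exact h2.add (continuousOn_id.mul (hGd.continuous.comp_continuousOn
      (continuousOn_id.prodMk (h2.prodMk hP.continuousOn))))
  have hzbox : ∀ P : ℝ → ℝ, Continuous P → (∀ s, P s ∈ Icc (h / 2) (2 * h)) →
      ∀ s ∈ Icc 0 s₀, (s, H (Γ P s), P s) ∈ box := fun P hP hPm s hs =>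
    ⟨⟨hs.1, by linarith [hs.2]⟩, hHbox _ (hΓmem P hP hPm s hs), hPm s⟩
  have hFm : ∀ P : ℝ → ℝ, Continuous P → (∀ s, P s ∈ Icc (h / 2) (2 * h)) →
      ∀ s ∈ Icc 0 s₀, F P s ∈ Icc (h / 2) (2 * h) := by
    intro P hP hPm s hs
    have h0 := hs.1
    have h1 := hHM _ (hΓmem P hP hPm s hs)
    have h2 := hB _ (hzbox P hP hPm s hs)
    rw [Real.norm_eq_abs] at h2
    have h3 : |F P s - h| ≤ h / 2 := by
      calc |F P s - h| = |(H (Γ P s) - h) + s * G (s, H (Γ P s), P s)| := by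
            simp only [hF]; congr 1; ring
        _ ≤ |H (Γ P s) - h| + |s * G (s, H (Γ P s), P s)| := abs_add_le _ _
        _ ≤ L * (s * (2 * h)) + s * B := by
            rw [abs_mul, abs_of_nonneg h0]
            gcongr
            exact h1.trans (by gcongr; exact hΓup P hP hPm s h0)
        _ = s * (L * (2 * h) + B) := by ring
        _ ≤ s₀ * (L * (2 * h) + B) := by
            have : 0 ≤ B := (abs_nonneg _).trans h2
            gcongr
            exact hs.2
        _ ≤ h / 2 := hs3
    rw [abs_le] at h3
    constructor <;> linarith [h3.1, h3.2]
  have hFlip : ∀ P Q : ℝ → ℝ, Continuous P → (∀ s, P s ∈ Icc (h / 2) (2 * h)) → Continuous Q →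
      (∀ s, Q s ∈ Icc (h / 2) (2 * h)) → ∀ D : ℝ, (∀ s ∈ Icc 0 s₀, |P s - Q s| ≤ D) →
      ∀ s ∈ Icc 0 s₀, |F P s - F Q s| ≤ D / 2 := by
    intro P Q hP hPm hQ hQm D hD s hs
    have h0 := hs.1
    have hD0 : 0 ≤ D := (abs_nonneg _).trans (hD s hs)
    have h1 : |H (Γ P s) - H (Γ Q s)| ≤ L * (D * s₀) :=
      (hL' _ (hΓmem P hP hPm s hs) _ (hΓmem Q hQ hQm s hs)).trans
        (by gcongr; exact hΓlip P Q hP hQ D hD s hs)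
    have h2 : |G (s, H (Γ P s), P s) - G (s, H (Γ Q s), Q s)| ≤ K * (D * (L + 1)) := by
      have h3 := hK.dist_le_mul _ (hzbox P hP hPm s hs) _ (hzbox Q hQ hQm s hs)
      rw [Real.dist_eq, Prod.dist_eq, Prod.dist_eq, dist_self, Real.dist_eq, Real.dist_eq] at h3
      refine h3.trans ?_
      gcongr
      refine max_le (by positivity) (max_le ?_ ?_)
      · refine h1.trans ?_
        have : D * s₀ ≤ D * 1 := by gcongr; linarith
        nlinarith [L.coe_nonneg]
      · refine (hD s hs).trans ?_
        nlinarith [L.coe_nonneg]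
    calc |F P s - F Q s| = |(H (Γ P s) - H (Γ Q s))
          + s * (G (s, H (Γ P s), P s) - G (s, H (Γ Q s), Q s))| := by
          simp only [hF]; congr 1; ring
      _ ≤ |H (Γ P s) - H (Γ Q s)| + |s * (G (s, H (Γ P s), P s) - G (s, H (Γ Q s), Q s))| :=
          abs_add_le _ _
      _ ≤ L * (D * s₀) + s₀ * (K * (D * (L + 1))) := by
          rw [abs_mul, abs_of_nonneg h0]
          gcongr
          exact hs.2
      _ = D * (s₀ * (L + K * (L + 1))) := by ring
      _ ≤ D * (1 / 2) := by gcongr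
      _ = D / 2 := by ring
  -- `F P` is known to be continuous only on `[0, s₀]`, as `H` is controlled only on its domain; the
  -- mean over `[0, s]` does not see the extension.
  set Ψ : (ℝ → ℝ) → ℝ → ℝ := fun P => IccExtend hs₀.le fun s => F P s with hΨ
  have hΨc : ∀ P : ℝ → ℝ, Continuous P → (∀ s, P s ∈ Icc (h / 2) (2 * h)) → Continuous (Ψ P) :=
    fun P hP hPm => (hFc P hP hPm).domRestrict.Icc_extend'
  have hΨF : ∀ P : ℝ → ℝ, ∀ s ∈ Icc 0 s₀, Ψ P s = F P s := fun P s hs =>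
    IccExtend_of_mem hs₀.le _ hs
  have hsubI : ∀ s ∈ Icc 0 s₀, Icc 0 s ⊆ Icc 0 s₀ := fun s hs => Icc_subset_Icc_right hs.2
  obtain ⟨P, hP, hPm, hfix⟩ := exists_eqOn_of_contracting hs₀.le (by linarith : h / 2 ≤ 2 * h)
    (fun P => singularMean (Ψ P))
    (fun P hP hPm => (continuousOn_singularMean (hΨc P hP hPm)).mono Icc_subset_Ici_self)
    (fun P hP hPm s hs => ⟨le_singularMean (hΨc P hP hPm) hs.1 fun t ht => by
        rw [hΨF P t (hsubI s hs ht)]; exact (hFm P hP hPm t (hsubI s hs ht)).1,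
      singularMean_le (hΨc P hP hPm) hs.1 fun t ht => by
        rw [hΨF P t (hsubI s hs ht)]; exact (hFm P hP hPm t (hsubI s hs ht)).2⟩)
    (fun P Q hP hPm hQ hQm D hD s hs =>
      abs_singularMean_sub_le (hΨc P hP hPm) (hΨc Q hQ hQm) hs.1 fun t ht => by
        rw [hΨF P t (hsubI s hs ht), hΨF Q t (hsubI s hs ht)]
        exact hFlip P Q hP hPm hQ hQm D hD t (hsubI s hs ht))
  have h00 : (0 : ℝ) ∈ Icc 0 s₀ := ⟨le_rfl, hs₀.le⟩
  have hΓ0 : Γ P 0 = 0 := by simp [hΓ]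
  refine ⟨s₀, hs₀, Γ P, P, fun s => (F P s - P s) / (4 * s ^ 2), hΓ0,
    fun s hs => hsub (hΓmem P hP hPm s hs), fun s _ => (hΓd P hP s).hasDerivWithinAt,
    hP.continuousOn, ?_, ?_, ?_, ?_, ?_⟩
  · have h1 := hfix h00
    simp only [singularMean_zero] at h1
    rw [← h1, hΨF P 0 h00]
    simp [hF]
  · intro s hs
    have hs' := Ioc_subset_Icc_self hs
    have h1 := (hasDerivAt_singularMean (hΨc P hP hPm) hs.1).hasDerivWithinAt (s := Icc 0 s₀)
    rw [hΨF P s hs'] at h1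
    have h2 := h1.congr (fun t ht => (hfix ht).symm) (hfix hs').symm
    have h3 : singularMean (Ψ P) s = P s := hfix hs'
    rwa [h3] at h2
  · intro s hs
    have h0 : 0 < s := hs.1
    simp only [hF, hG]
    field_simp
    ring
  · intro s hs
    have h0 : 0 < s := hs.1
    exact lt_of_lt_of_le (by positivity) (hΓlow P hP hPm s hs.1.le)
  · intro s hs
    exact lt_of_lt_of_le (by positivity) (hPm s).1

end Existence

/-! ### Uniqueness by an energy estimate -/

section Uniqueness

/-- Uniqueness for the singular initial value problem, by a weighted energy estimate. -/
lemma eqOn_of_singular_ivp {n : ℕ} {H β γ p p' q q' : ℝ → ℝ} {d₀ s₀ : ℝ} (hs₀ : 0 ≤ s₀)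
    (hH : ContDiffOn ℝ 1 H (Ico 0 d₀))
    (hβm : MapsTo β (Icc 0 s₀) (Ico 0 d₀)) (hγm : MapsTo γ (Icc 0 s₀) (Ico 0 d₀))
    (h0 : β 0 = γ 0)
    (hβ : ∀ s ∈ Icc 0 s₀, HasDerivWithinAt β (p s) (Icc 0 s₀) s)
    (hγ : ∀ s ∈ Icc 0 s₀, HasDerivWithinAt γ (q s) (Icc 0 s₀) s)
    (hp : ContinuousOn p (Icc 0 s₀)) (hq : ContinuousOn q (Icc 0 s₀))
    (hp' : ∀ s ∈ Ioc 0 s₀, HasDerivWithinAt p (p' s) (Icc 0 s₀) s)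
    (hq' : ∀ s ∈ Ioc 0 s₀, HasDerivWithinAt q (q' s) (Icc 0 s₀) s)
    (hpe : ∀ s ∈ Ioc 0 s₀, 4 * s ^ 2 * p' s + 4 * s * p s
      + (1 + 4 * s ^ 2 * p s ^ 2) * ((1 - 2 * (n : ℝ) * s) * p s - H (β s)) = 0)
    (hqe : ∀ s ∈ Ioc 0 s₀, 4 * s ^ 2 * q' s + 4 * s * q s
      + (1 + 4 * s ^ 2 * q s ^ 2) * ((1 - 2 * (n : ℝ) * s) * q s - H (γ s)) = 0) :
    EqOn β γ (Icc 0 s₀) := by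
  have hne : (Icc 0 s₀).Nonempty := ⟨0, le_rfl, hs₀⟩
  have hβc : ContinuousOn β (Icc 0 s₀) := fun s hs => (hβ s hs).continuousWithinAt
  have hγc : ContinuousOn γ (Icc 0 s₀) := fun s hs => (hγ s hs).continuousWithinAt
  -- By compactness both solutions stay away from `d₀`, near which `H` need not be Lipschitz.
  obtain ⟨c, hcd, hβr, hγr⟩ : ∃ c < d₀, (∀ s ∈ Icc 0 s₀, β s ∈ Icc 0 c) ∧
      ∀ s ∈ Icc 0 s₀, γ s ∈ Icc 0 c := by
    obtain ⟨x, hx, hxm⟩ := isCompact_Icc.exists_isMaxOn hne hβc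
    obtain ⟨y, hy, hym⟩ := isCompact_Icc.exists_isMaxOn hne hγc
    exact ⟨max (β x) (γ y), max_lt (hβm hx).2 (hγm hy).2,
      fun s hs => ⟨(hβm hs).1, (hxm hs).trans (le_max_left _ _)⟩,
      fun s hs => ⟨(hγm hs).1, (hym hs).trans (le_max_right _ _)⟩⟩
  have hsub : Icc 0 c ⊆ Ico 0 d₀ := fun x hx => ⟨hx.1, hx.2.trans_lt hcd⟩
  obtain ⟨L, hL⟩ := (hH.mono hsub).exists_lipschitzOnWith one_ne_zero (convex_Icc 0 c)
    isCompact_Icc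
  obtain ⟨M, hM⟩ := isCompact_Icc.exists_bound_of_continuousOn (hH.mono hsub).continuousOn
  obtain ⟨N₁, hN₁⟩ := isCompact_Icc.exists_bound_of_continuousOn hp
  obtain ⟨N₂, hN₂⟩ := isCompact_Icc.exists_bound_of_continuousOn hq
  set N := max N₁ N₂
  set G : ℝ × ℝ × ℝ → ℝ := fun z =>
    (2 * (n : ℝ) - 4) * z.2.2 + 4 * z.1 * z.2.2 ^ 2 * (z.2.1 - (1 - 2 * (n : ℝ) * z.1) * z.2.2)
    with hG
  have hGd : ContDiff ℝ 1 G := by fun_prop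
  obtain ⟨K, hK⟩ := hGd.contDiffOn.exists_lipschitzOnWith one_ne_zero
    ((convex_Icc 0 s₀).prod ((convex_Icc (-M) M).prod (convex_Icc (-N) N)))
    (isCompact_Icc.prod (isCompact_Icc.prod isCompact_Icc))
  set A : ℝ := L * (1 + s₀ * K) with hA
  have hest : ∀ s ∈ Ioc 0 s₀, |4 * s ^ 2 * (p' s - q' s) + (p s - q s)|
      ≤ A * |β s - γ s| + K * s * |p s - q s| := by
    intro s hs
    have hs' := Ioc_subset_Icc_self hs
    have hs0 : 0 < s := hs.1
    have h1 : |H (β s) - H (γ s)| ≤ L * |β s - γ s| := by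
      simpa [Real.dist_eq] using hL.dist_le_mul _ (hβr s hs') _ (hγr s hs')
    have h2 : |G (s, H (β s), p s) - G (s, H (γ s), q s)|
        ≤ K * (L * |β s - γ s| + |p s - q s|) := by
      have h3 := hK.dist_le_mul (s, H (β s), p s)
        ⟨hs', abs_le.1 (hM _ (hβr s hs')), abs_le.1 ((hN₁ s hs').trans (le_max_left _ _))⟩
        (s, H (γ s), q s)
        ⟨hs', abs_le.1 (hM _ (hγr s hs')), abs_le.1 ((hN₂ s hs').trans (le_max_right _ _))⟩
      rw [Real.dist_eq, Prod.dist_eq, Prod.dist_eq, dist_self, Real.dist_eq, Real.dist_eq] at h3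
      refine h3.trans ?_
      gcongr
      have : 0 ≤ L * |β s - γ s| := by positivity
      refine max_le (by positivity) (max_le ?_ ?_)
      · linarith [abs_nonneg (p s - q s)]
      · simp only; linarith
    calc |4 * s ^ 2 * (p' s - q' s) + (p s - q s)|
        = |(H (β s) - H (γ s)) + s * (G (s, H (β s), p s) - G (s, H (γ s), q s))| := by
          congr 1
          simp only [hG]
          linear_combination hpe s hs - hqe s hs
      _ ≤ |H (β s) - H (γ s)| + |s * (G (s, H (β s), p s) - G (s, H (γ s), q s))| :=
          abs_add_le _ _
      _ ≤ L * |β s - γ s| + s * (K * (L * |β s - γ s| + |p s - q s|)) := by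
          rw [abs_mul, abs_of_pos hs0]
          gcongr
      _ = L * |β s - γ s| + s * (K * (L * |β s - γ s|)) + K * s * |p s - q s| := by ring
      _ ≤ L * |β s - γ s| + s₀ * (K * (L * |β s - γ s|)) + K * s * |p s - q s| := by
          gcongr
          exact hs.2
      _ = A * |β s - γ s| + K * s * |p s - q s| := by rw [hA]; ring
  set R : ℝ := (A + 2) ^ 2 + (4 + K) ^ 2 with hR
  -- The weight `2 s²` makes `4 s² (p' - q')` appear in `Φ'`; by `hest` this is `-(p - q)` up to a
  -- small error, so `Φ'` contains `-(p - q)²`.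
  set Φ : ℝ → ℝ := fun s => (β s - γ s) ^ 2 + 2 * s ^ 2 * (p s - q s) ^ 2 with hΦ
  set Φ' : ℝ → ℝ := fun s => 2 * (β s - γ s) * (p s - q s) + 4 * s * (p s - q s) ^ 2
    + (p s - q s) * (4 * s ^ 2 * (p' s - q' s)) with hΦ'
  have hΦd : ∀ s ∈ Ioo 0 s₀, HasDerivAt Φ (Φ' s) s := by
    intro s hs
    have hn := Icc_mem_nhds hs.1 hs.2
    have hs1 := Ioo_subset_Icc_self hs
    have hs2 := Ioo_subset_Ioc_self hs
    have h1 := ((((hβ s hs1).hasDerivAt hn).sub ((hγ s hs1).hasDerivAt hn)).pow 2).add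
      (((hasDerivAt_pow 2 s).const_mul 2).mul
        ((((hp' s hs2).hasDerivAt hn).sub ((hq' s hs2).hasDerivAt hn)).pow 2))
    refine h1.congr_deriv ?_
    simp only [hΦ', Pi.sub_apply, Pi.pow_apply]
    push_cast
    ring
  have hΦle : ∀ s ∈ Ioo 0 s₀, Φ' s ≤ R * Φ s := by
    intro s hs
    have h1 := hest s (Ioo_subset_Ioc_self hs)
    have hs0 : 0 < s := hs.1
    simp only [hΦ', hΦ]
    set w := β s - γ s
    set u := p s - q s
    set z := 4 * s ^ 2 * (p' s - q' s)
    have h2 : u * (z + u) ≤ |u| * (A * |w| + K * s * |u|) := by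
      refine (le_abs_self _).trans ?_
      rw [abs_mul]
      gcongr
    have h3 : w * u ≤ |w| * |u| := by rw [← abs_mul]; exact le_abs_self _
    have hu2 : |u| ^ 2 = u ^ 2 := sq_abs u
    have hw2 : |w| ^ 2 = w ^ 2 := sq_abs w
    -- Each of the two error terms is split by Young's inequality so as to use half of the damping
    -- `-u²`; the remainders are bounded by `R * Φ`.
    have h4 : (A + 2) * |w| * |u| ≤ u ^ 2 / 2 + (A + 2) ^ 2 * w ^ 2 / 2 := by
      rw [← hu2, ← hw2]; nlinarith [sq_nonneg (|u| - (A + 2) * |w|)]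
    have h5 : (4 + K) * s * u ^ 2 ≤ u ^ 2 / 2 + (4 + K) ^ 2 * (s ^ 2 * u ^ 2) / 2 := by
      nlinarith [sq_nonneg (u * (1 - (4 + K) * s))]
    have h6 : 2 * w * u + 4 * s * u ^ 2 + u * z
        ≤ (A + 2) * |w| * |u| + (4 + K) * s * u ^ 2 - u ^ 2 := by
      have : |u| * (A * |w| + K * s * |u|) = A * |w| * |u| + K * s * u ^ 2 := by
        rw [← hu2]; ring
      nlinarith
    have h7 : 0 ≤ (A + 2) ^ 2 * w ^ 2 := by positivity
    have h8 : 0 ≤ (4 + (K : ℝ)) ^ 2 * (s ^ 2 * u ^ 2) := by positivity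
    have h9 : 0 ≤ (A + 2) ^ 2 * (s ^ 2 * u ^ 2) := by positivity
    have h10 : 0 ≤ (4 + (K : ℝ)) ^ 2 * w ^ 2 := by positivity
    rw [hR]
    linarith
  have hanti : AntitoneOn (fun s => Φ s * Real.exp (-R * s)) (Icc 0 s₀) := by
    have hd : ∀ s ∈ Ioo 0 s₀, HasDerivAt (fun s => Φ s * Real.exp (-R * s))
        ((Φ' s - R * Φ s) * Real.exp (-R * s)) s := by
      intro s hs
      have h1 : HasDerivAt (fun s => Real.exp (-R * s)) (Real.exp (-R * s) * -R) s := by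
        simpa using ((hasDerivAt_id s).const_mul (-R)).exp
      refine ((hΦd s hs).mul h1).congr_deriv ?_
      ring
    refine antitoneOn_of_deriv_nonpos (convex_Icc 0 s₀) (by fun_prop) ?_ ?_
    · rw [interior_Icc]
      exact fun s hs => (hd s hs).differentiableAt.differentiableWithinAt
    · rw [interior_Icc]
      intro s hs
      rw [(hd s hs).deriv]
      exact mul_nonpos_of_nonpos_of_nonneg (by linarith [hΦle s hs]) (Real.exp_pos _).le
  intro s hs
  have h1 := hanti ⟨le_rfl, hs₀⟩ hs hs.1
  have h2 : Φ 0 = 0 := by simp [hΦ, h0]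
  simp only [h2, zero_mul] at h1
  have h3 : Φ s ≤ 0 := nonpos_of_mul_nonpos_left h1 (Real.exp_pos _)
  have h4 : (β s - γ s) ^ 2 ≤ 0 := by
    have : 0 ≤ 2 * s ^ 2 * (p s - q s) ^ 2 := by positivity
    simp only [hΦ] at h3
    linarith
  exact sub_eq_zero.1 (pow_eq_zero_iff two_ne_zero |>.1 (le_antisymm h4 (sq_nonneg _)))

end Uniqueness

/-! ### Assembly of the theorem -/

lemma div_add_eq_zero_iff_cleared {n : ℕ} (s p p' x : ℝ) :
    (1 - 2 * (n : ℝ) * s) * p - x + 4 * ((s * p + s ^ 2 * p') / (1 + 4 * s ^ 2 * p ^ 2)) = 0 ↔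
      4 * s ^ 2 * p' + 4 * s * p
        + (1 + 4 * s ^ 2 * p ^ 2) * ((1 - 2 * (n : ℝ) * s) * p - x) = 0 := by
  have hne : 1 + 4 * s ^ 2 * p ^ 2 ≠ 0 := by positivity
  rw [← mul_eq_zero_iff_left hne (b := _ - _ + _)]
  field_simp
  constructor <;> intro h <;> linear_combination h

lemma IsSmoothSolution.eqOn {n : ℕ} {H β γ : ℝ → ℝ} {d₀ s₀ : ℝ} (hs₀ : 0 < s₀)
    (hH : ContDiffOn ℝ ∞ H (Ico 0 d₀)) (hβ : IsSmoothSolution n H d₀ s₀ β)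
    (hγ : IsSmoothSolution n H d₀ s₀ γ) : EqOn β γ (Icc 0 s₀) := by
  have hI : UniqueDiffOn ℝ (Icc 0 s₀) := uniqueDiffOn_Icc hs₀
  have hβ' := hβ.smooth.derivWithin_infty hI
  have hγ' := hγ.smooth.derivWithin_infty hI
  have key : ∀ α, IsSmoothSolution n H d₀ s₀ α → ∀ s ∈ Ioc 0 s₀,
      4 * s ^ 2 * derivWithin (derivWithin α (Icc 0 s₀)) (Icc 0 s₀) s
        + 4 * s * derivWithin α (Icc 0 s₀) s + (1 + 4 * s ^ 2 * derivWithin α (Icc 0 s₀) s ^ 2) *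
          ((1 - 2 * (n : ℝ) * s) * derivWithin α (Icc 0 s₀) s - H (α s)) = 0 := by
    intro α hα s hs
    have := hα.equation s hs
    rw [iteratedDerivWithin_succ', iteratedDerivWithin_one] at this
    exact (div_add_eq_zero_iff_cleared _ _ _ _).1 this
  exact eqOn_of_singular_ivp hs₀.le (hH.of_le (by exact_mod_cast le_top)) hβ.mapsTo hγ.mapsTo
    (hβ.initial.trans hγ.initial.symm)
    (fun s hs => (hβ.smooth.differentiableOn (by simp) s hs).hasDerivWithinAt)
    (fun s hs => (hγ.smooth.differentiableOn (by simp) s hs).hasDerivWithinAt)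
    hβ'.continuousOn hγ'.continuousOn
    (fun s hs => (hβ'.differentiableOn (by simp) s (Ioc_subset_Icc_self hs)).hasDerivWithinAt)
    (fun s hs => (hγ'.differentiableOn (by simp) s (Ioc_subset_Icc_self hs)).hasDerivWithinAt)
    (key β hβ) (key γ hγ)

theorem mainTheorem2 (n : ℕ) (d₀ : ℝ) (hd₀ : 0 < d₀) (H : ℝ → ℝ)
    (hH : ContDiffOn ℝ ∞ H (Set.Ico 0 d₀)) (hH0 : 0 < H 0) :
    ∃ A : ℕ → ℝ,
      (IsFormalSolution n H d₀ A ∧ ∀ B : ℕ → ℝ, IsFormalSolution n H d₀ B → B = A) ∧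
      ∃ s₀ : ℝ, 0 < s₀ ∧ ∃ γ : ℝ → ℝ,
        IsSmoothSolution n H d₀ s₀ γ ∧
        (∀ β : ℝ → ℝ, IsSmoothSolution n H d₀ s₀ β → Set.EqOn β γ (Set.Icc 0 s₀)) ∧
        (∀ s ∈ Set.Ioc 0 s₀, 0 < γ s) ∧
        (∀ s ∈ Set.Icc 0 s₀, 0 < derivWithin γ (Set.Icc 0 s₀) s) ∧
        ∀ k : ℕ, iteratedDerivWithin k γ (Set.Icc 0 s₀) 0 = A k := by
  obtain ⟨s₀, hs₀, γ, p, p', hγ0, hmaps, hγ, hp, hp0, hp', heq, hγpos, hppos⟩ :=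
    exists_solution_near_zero n hd₀ hH hH0
  have hI : UniqueDiffOn ℝ (Icc 0 s₀) := uniqueDiffOn_Icc hs₀
  have h0 : (0 : ℝ) ∈ Icc 0 s₀ := ⟨le_rfl, hs₀.le⟩
  have hsm := contDiffOn_of_nonlinear_singular_ode hs₀ hH hmaps hγ hp hp0 hp' heq
  have hd : EqOn (derivWithin γ (Icc 0 s₀)) p (Icc 0 s₀) := fun s hs =>
    (hγ s hs).derivWithin (hI s hs)
  have hd2 : ∀ s ∈ Ioc 0 s₀, derivWithin (derivWithin γ (Icc 0 s₀)) (Icc 0 s₀) s = p' s := by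
    intro s hs
    rw [derivWithin_congr hd (hd (Ioc_subset_Icc_self hs))]
    exact (hp' s hs).derivWithin (hI s (Ioc_subset_Icc_self hs))
  have hsol : IsSmoothSolution n H d₀ s₀ γ := by
    refine ⟨hsm, hmaps, hγ0, fun s hs => ?_⟩
    rw [iteratedDerivWithin_succ', iteratedDerivWithin_one, hd2 s hs,
      hd (Ioc_subset_Icc_self hs)]
    exact (div_add_eq_zero_iff_cleared _ _ _ _).2 (heq s hs)
  have hformal : ClearedFormalEquation n (taylorSeriesWithin H (Ico 0 d₀))
      (taylorSeriesWithin γ (Icc 0 s₀)) := by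
    refine cleared_taylorSeriesWithin hI h0 (uniqueDiffOn_Ico 0 d₀) hsm hH hmaps hγ0 fun s hs => ?_
    -- The differential equation is given only for `s > 0`; at `s = 0` the cleared equation reduces
    -- to `p 0 = H (γ 0)`.
    rcases hs.1.eq_or_lt with h | h
    · subst h
      rw [hd h0, hp0]
      ring
    · rw [hd2 s ⟨h, hs.2⟩, hd hs]
      linear_combination heq s ⟨h, hs.2⟩
  -- The `A k` are taken to be the derivatives of `γ` at `0`, so the last claim holds by definition
  -- and only formal uniqueness remains.
  refine ⟨fun k => iteratedDerivWithin k γ (Icc 0 s₀) 0,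
    ⟨⟨by simpa using hγ0, (formalEquation_iff_cleared _ _ _).2 hformal⟩, fun B hB => ?_⟩,
    s₀, hs₀, γ, hsol, fun β hβ => hβ.eqOn hs₀ hH hsol, hγpos,
    fun s hs => by rw [hd hs]; exact hppos s hs, fun k => rfl⟩
  have hBeq := ClearedFormalEquation.unique
    (by simp [expSeries, ← PowerSeries.coeff_zero_eq_constantCoeff_apply, hB.initial])
    (by rw [constantCoeff_taylorSeriesWithin, hγ0])
    ((formalEquation_iff_cleared _ _ _).1 hB.equation) hformal
  funext k
  have := congrArg (PowerSeries.coeff k) hBeq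
  simp only [expSeries, taylorSeriesWithin, PowerSeries.coeff_mk] at this
  exact (div_left_inj' (by positivity)).1 this
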